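/- Let $m,k,n\ge 0$ be integers with $k<\min\{m,n\}$, and let $\mathcal M(W_1,W_2)=W_1W_2$ for $W_1\in\mathbb R^{m\times k}$, $W_2\in\mathbb R^{k\times n}$. The range of $\mathcal M$ is $\mathcal R=\{Z\in\mathbb R^{m\times n}:\operatorname{rank} Z\le k\}$. Let $\|\cdot\|$ be the Frobenius norm. For $\varepsilon,\delta>0$ say that $\delta$ is admissible for $\varepsilon$ at $(W_1,W_2)$ if every $Z\in\mathcal R$ with $\|Z-W_1W_2\|<\delta$ can be written as $Z=W_1'W_2'$ with $\|W_1'-W_1\|<\varepsilon$ and $\|W_2'-W_2\|<\varepsilon$. The mapping $\mathcal M$ is locally open at $(W_1,W_2)$ in its range if every $\varepsilon>0$ has an admissible $\delta>0$. Let $\mathcal N(\cdot)$ and $\mathcal C(\cdot)$ denote the null space and the column space. (a) If $\operatorname{rank} W_1\neq\operatorname{rank} W_2$, then $\mathcal M$ is not locally open at $(W_1,W_2)$ in its range. (b) If $\operatorname{rank} W_1=\operatorname{rank} W_2$, then the following statements are equivalent: (i) there is $\widetilde W_1\in\mathbb R^{m\times k}$ with $\widetilde W_1W_2=0$ and $W_1+\widetilde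 W_1$ of full column rank $k$; (ii) there is $\widetilde W_2\in\mathbb R^{k\times n}$ with $W_1\widetilde W_2=0$ and $W_2+\widetilde W_2$ of full row rank $k$; (iii) $\dim(\mathcal N(W_1)\cap\mathcal C(W_2))=0$; (iv) $\dim(\mathcal N(W_2^T)\cap\mathcal C(W_1^T))=0$; (v) $\mathcal M$ is locally open at $(W_1,W_2)$ in its range. (c) If $\mathcal M$ is locally open at $(W_1,W_2)$ in its range, then one can choose for every $\varepsilon>0$ an admissible $\delta(\varepsilon)>0$ such that, as $\varepsilon\to0^+$, $\delta(\varepsilon)=O(\varepsilon)$ and $\varepsilon^2=O(\delta(\varepsilon))$; if moreover $\operatorname{rank} W_1=k$, then also $\varepsilon=O(\delta(\varepsilon))$, so that $\delta$ is exactly of order $\varepsilon$. -/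

import Mathlib

open Filter Topology Asymptotics

attribute [local instance] Matrix.frobeniusNormedAddCommGroup

/-- The inclusion `B_δ(F w) ∩ R ⊆ F (B_ε(w))`: every point of `R` at distance less than `δ`
from `F w` is attained by `F` at some point at distance less than `ε` from `w`. -/
def CoversBall {X Y : Type*} [PseudoMetricSpace X] [PseudoMetricSpace Y]
    (F : X → Y) (R : Set Y) (w : X) (ε δ : ℝ) : Prop :=
  Metric.ball (F w) δ ∩ R ⊆ F '' Metric.ball w ε

/-- `F` is locally open at `w` relative to the set `R` (typically its range). -/
def LocallyOpenAtIn {X Y : Type*} [PseudoMetricSpace X] [PseudoMetricSpace Y]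
    (F : X → Y) (R : Set Y) (w : X) : Prop :=
  ∀ ε : ℝ, 0 < ε → ∃ δ : ℝ, 0 < δ ∧ CoversBall F R w ε δ

/-- The matrix multiplication mapping `(W₁, W₂) ↦ W₁ W₂`. The metric on pairs is the maximum of
the two Frobenius distances, so that a ball around a pair is a product of two balls. -/
def matMul (m k n : ℕ) :
    Matrix (Fin m) (Fin k) ℝ × Matrix (Fin k) (Fin n) ℝ → Matrix (Fin m) (Fin n) ℝ :=
  fun W => W.1 * W.2

/-- The `m × n` real matrices of rank at most `min (m, n, k)`: the range of `matMul m k n`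
(see `range_matMul`). -/
def lowRank (m k n : ℕ) : Set (Matrix (Fin m) (Fin n) ℝ) :=
  {Z | Z.rank ≤ min (min m n) k}

/-- The null space of a matrix. -/
def nullSp {m n : ℕ} (A : Matrix (Fin m) (Fin n) ℝ) : Submodule ℝ (Fin n → ℝ) :=
  LinearMap.ker A.mulVecLin

/-- The column space of a matrix. -/
def colSp {m n : ℕ} (A : Matrix (Fin m) (Fin n) ℝ) : Submodule ℝ (Fin m → ℝ) :=
  LinearMap.range A.mulVecLin

/-- The set `lowRank m k n` is the range of the multiplication mapping. -/
theorem range_matMul (m k n : ℕ) : Set.range (matMul m k n) = lowRank m k n := by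
  ext Z
  constructor
  · rintro ⟨⟨A, B⟩, rfl⟩
    change (A * B).rank ≤ min (min m n) k
    refine le_min (le_min ?_ ?_) ?_
    · simpa [matMul] using (A * B).rank_le_card_height
    · simpa [matMul] using (A * B).rank_le_card_width
    · refine (Matrix.rank_mul_le_left A B).trans ?_
      simpa using A.rank_le_card_width
  · intro hZ
    have hk : Module.finrank ℝ (LinearMap.range Z.mulVecLin) ≤ Module.finrank ℝ (Fin k → ℝ) := by
      have : Z.rank ≤ k := le_trans hZ (min_le_right _ _)
      simpa [Matrix.rank] using this
    obtain ⟨f, hf⟩ := finrank_le_iff_exists_linearMap.1 hk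
    obtain ⟨g, hg⟩ := LinearMap.exists_leftInverse_of_injective f (LinearMap.ker_eq_bot.2 hf)
    refine ⟨(LinearMap.toMatrix' ((LinearMap.range Z.mulVecLin).subtype ∘ₗ g),
      LinearMap.toMatrix' (f ∘ₗ Z.mulVecLin.rangeRestrict)), ?_⟩
    simp only [matMul]
    rw [← LinearMap.toMatrix'_comp]
    have h : ((LinearMap.range Z.mulVecLin).subtype ∘ₗ g) ∘ₗ (f ∘ₗ Z.mulVecLin.rangeRestrict)
        = Matrix.toLin' Z := by
      ext x : 1
      ext i
      have := LinearMap.congr_fun hg (Z.mulVecLin.rangeRestrict (Pi.single x 1))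
      simp only [LinearMap.comp_apply, LinearMap.id_apply] at this
      simp [this]
    rw [h, LinearMap.toMatrix'_toLin']

/-! Everything reduces to rank(W₁W₂) = rank W₁ = rank W₂, that is, ℝ^k = N(W₁) ⊕ C(W₂).

Necessity (`rank_mul_eq_right_of_locallyOpenAtIn` and its transpose): if W₁W₂v = 0 but W₂v ≠ 0,
perturb W₁W₂ slightly to a Z of rank exactly k with Zv = 0. Any factorization Z = XY then has N(Y) =
N(Z), so Yv = 0, which is impossible for Y near W₂.

Sufficiency: the splitting of ℝ^k gives a Schur complement (`exists_approx_factorization`): Z = X'Y'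
+ S, with X', Y' within O(‖Z - W₁W₂‖) of W₁, W₂ and S of that size with rank at most q = k - rank
W₁. Since X' vanishes on N(W₁) and Y' has no component there, S = PQ fits into these q free
directions, as tP and t⁻¹Q, without cross terms. Taking t of order ε costs δ of order ε². If rank W₁
= k there is no remainder and δ is linear in ε. -/

/-! ### Rank identities and perturbations of prescribed kernel -/

theorem rank_add_finrank_nullSp {m n : ℕ} (A : Matrix (Fin m) (Fin n) ℝ) :
    A.rank + Module.finrank ℝ (nullSp A) = n := by
  have h := A.mulVecLin.finrank_range_add_finrank_ker
  rw [Module.finrank_fin_fun] at h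
  exact h

/-- Rank-nullity for `A` restricted to the column space of `B`. -/
theorem rank_mul_add_finrank {m k n : ℕ} (A : Matrix (Fin m) (Fin k) ℝ)
    (B : Matrix (Fin k) (Fin n) ℝ) :
    (A * B).rank + Module.finrank ℝ ↥(nullSp A ⊓ colSp B) = B.rank := by
  have h := (A.mulVecLin.domRestrict (colSp B)).finrank_range_add_finrank_ker
  rw [LinearMap.range_domRestrict, LinearMap.ker_domRestrict] at h
  have h1 : (colSp B).map A.mulVecLin = LinearMap.range (A * B).mulVecLin := by
    rw [Matrix.mulVecLin_mul, LinearMap.range_comp]; rfl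
  have h2 : Module.finrank ℝ ↥((LinearMap.ker A.mulVecLin).comap (colSp B).subtype) =
      Module.finrank ℝ ↥(nullSp A ⊓ colSp B) := by
    rw [← Submodule.finrank_map_subtype_eq, Submodule.map_comap_subtype, inf_comm]; rfl
  rw [h1, h2] at h
  exact h

theorem matrix_rank_add_le {m n : ℕ} (A B : Matrix (Fin m) (Fin n) ℝ) :
    (A + B).rank ≤ A.rank + B.rank := by
  have : LinearMap.range (A + B).mulVecLin ≤
      LinearMap.range A.mulVecLin ⊔ LinearMap.range B.mulVecLin := by
    rintro _ ⟨x, rfl⟩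
    rw [Matrix.mulVecLin_add]
    exact Submodule.add_mem_sup ⟨x, rfl⟩ ⟨x, rfl⟩
  exact (Submodule.finrank_mono this).trans (Submodule.finrank_add_le_finrank_add_finrank _ _)

theorem rank_eq_width_of_injective {m n : ℕ} {A : Matrix (Fin m) (Fin n) ℝ}
    (h : Function.Injective A.mulVecLin) : A.rank = n := by
  have := LinearMap.finrank_range_of_inj h
  simpa [Matrix.rank] using this

/-- A linear map can be made injective by adding any nonzero multiple of a map that vanishes on a
given complement of its kernel, provided that the dimensions allow it. -/
theorem exists_forall_injective_add_smul {V W : Type*} [AddCommGroup V] [Module ℝ V]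
    [AddCommGroup W] [Module ℝ W] [FiniteDimensional ℝ V] [FiniteDimensional ℝ W]
    (f : V →ₗ[ℝ] W) (C : Submodule ℝ V) (hC : IsCompl (LinearMap.ker f) C)
    (hd : Module.finrank ℝ V ≤ Module.finrank ℝ W) :
    ∃ g : V →ₗ[ℝ] W, (∀ x ∈ C, g x = 0) ∧
      ∀ η : ℝ, η ≠ 0 → Function.Injective (f + η • g) := by
  obtain ⟨R, hR⟩ := (LinearMap.range f).exists_isCompl
  have h1 := Submodule.finrank_add_eq_of_isCompl hR
  have h2 := f.finrank_range_add_finrank_ker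
  obtain ⟨i, hi⟩ := finrank_le_iff_exists_linearMap.1
    (show Module.finrank ℝ (LinearMap.ker f) ≤ Module.finrank ℝ R by omega)
  -- `g` embeds ker f into a complement of range f, so f x + η g x = 0 forces both terms to vanish.
  refine ⟨R.subtype ∘ₗ i ∘ₗ Submodule.projectionOnto _ C hC, fun x hx => ?_, fun η hη => ?_⟩
  · simp [(Submodule.projectionOnto_apply_eq_zero_iff hC).2 hx]
  · rw [← LinearMap.ker_eq_bot, LinearMap.ker_eq_bot']
    intro x hx
    set y := Submodule.projectionOnto _ C hC x with hy
    have hx' : f x = -(η • (i y : W)) := by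
      rw [eq_neg_iff_add_eq_zero]; simpa using hx
    have h0 : f x = 0 := by
      have := Submodule.disjoint_def.1 hR.disjoint (f x) ⟨x, rfl⟩
      exact this (hx' ▸ R.neg_mem (R.smul_mem _ (i y).2))
    have hiy : i y = 0 := by
      have : η • (i y : W) = 0 := by rw [← neg_eq_zero, ← hx', h0]
      simpa [hη] using this
    have hy0 : y = 0 := hi (by rw [hiy, map_zero])
    rw [hy, Submodule.projectionOnto_apply_of_mem_left hC (x := x) h0] at hy0
    exact congrArg Subtype.val hy0

theorem Submodule.exists_between_finrank_eq {V : Type*} [AddCommGroup V] [Module ℝ V]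
    [FiniteDimensional ℝ V] {p q : Submodule ℝ V} (hpq : p ≤ q) {d : ℕ}
    (hp : Module.finrank ℝ p ≤ d) (hq : d ≤ Module.finrank ℝ q) :
    ∃ D : Submodule ℝ V, p ≤ D ∧ D ≤ q ∧ Module.finrank ℝ D = d := by
  induction d, hp using Nat.le_induction with
  | base => exact ⟨p, le_rfl, hpq, rfl⟩
  | succ d hd ih =>
    obtain ⟨D, hpD, hDq, hD⟩ := ih (by omega)
    obtain ⟨x, hxq, hxD⟩ := SetLike.exists_of_lt (lt_of_le_of_ne hDq (by rintro rfl; omega))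
    refine ⟨D ⊔ Submodule.span ℝ {x}, hpD.trans le_sup_left,
      sup_le hDq (by simpa using hxq), ?_⟩
    rw [Submodule.finrank_sup_span_singleton hxD, hD]

/-- A matrix `Z` of rank at
most `k` and a vector `v ∈ N(Z)` have arbitrarily small perturbations of `Z` of rank `k` that
still kill `v`. -/
theorem exists_forall_nullSp_add_smul_eq {m n k : ℕ} (Z : Matrix (Fin m) (Fin n) ℝ)
    (hkm : k ≤ m) (hkn : k < n) (hZ : Z.rank ≤ k) {v : Fin n → ℝ} (hv : v ∈ nullSp Z) :
    ∃ (D : Submodule ℝ (Fin n → ℝ)) (E : Matrix (Fin m) (Fin n) ℝ), v ∈ D ∧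
      Module.finrank ℝ D = n - k ∧ ∀ η : ℝ, η ≠ 0 → nullSp (Z + η • E) = D := by
  have hr := rank_add_finrank_nullSp Z
  -- Here k < n matters: `D` needs dimension at least 1 to contain `v`. The perturbation is then
  -- made injective on the k-dimensional quotient by `D`.
  obtain ⟨D, hvD, hDZ, hD⟩ := Submodule.exists_between_finrank_eq (p := Submodule.span ℝ {v})
    (q := nullSp Z) (d := n - k) (by simpa using hv)
    ((finrank_span_le_card _).trans (by simp; omega)) (by omega)
  have hDZ : D ≤ LinearMap.ker Z.mulVecLin := hDZ
  have hq := D.finrank_quotient_add_finrank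
  simp only [Module.finrank_fin_fun] at hq
  obtain ⟨C, hC⟩ := (LinearMap.ker (D.liftQ Z.mulVecLin hDZ)).exists_isCompl
  obtain ⟨g, -, hg⟩ := exists_forall_injective_add_smul (D.liftQ Z.mulVecLin hDZ) C hC
    (by simp; omega)
  refine ⟨D, LinearMap.toMatrix' (g ∘ₗ D.mkQ), hvD (Submodule.mem_span_singleton_self v), hD,
    fun η hη => ?_⟩
  have : (Z + η • LinearMap.toMatrix' (g ∘ₗ D.mkQ)).mulVecLin =
      (D.liftQ Z.mulVecLin hDZ + η • g) ∘ₗ D.mkQ := by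
    rw [LinearMap.add_comp, Submodule.liftQ_mkQ, Matrix.mulVecLin_add, LinearMap.smul_comp,
      ← Matrix.toLin'_apply', ← Matrix.toLin'_apply' (η • _), map_smul, Matrix.toLin'_toMatrix']
  rw [nullSp, this, LinearMap.ker_comp, LinearMap.ker_eq_bot.2 (hg η hη)]
  exact D.ker_mkQ

/-! ### Necessity of the rank equalities -/

theorem mem_ball_matrix_prod {m k n : ℕ} {W V : Matrix (Fin m) (Fin k) ℝ × Matrix (Fin k) (Fin n) ℝ}
    {ε : ℝ} : V ∈ Metric.ball W ε ↔ ‖V.1 - W.1‖ < ε ∧ ‖V.2 - W.2‖ < ε := by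
  rw [Metric.mem_ball, Prod.dist_eq, max_lt_iff, dist_eq_norm, dist_eq_norm]

theorem LocallyOpenAtIn.transpose {m k n : ℕ} {W₁ : Matrix (Fin m) (Fin k) ℝ}
    {W₂ : Matrix (Fin k) (Fin n) ℝ}
    (h : LocallyOpenAtIn (matMul m k n) (lowRank m k n) (W₁, W₂)) :
    LocallyOpenAtIn (matMul n k m) (lowRank n k m) (W₂.transpose, W₁.transpose) := by
  intro ε hε
  obtain ⟨δ, hδ, h⟩ := h ε hε
  refine ⟨δ, hδ, fun Z ⟨hZ, hZr⟩ => ?_⟩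
  obtain ⟨⟨X, Y⟩, hXY, hZ'⟩ := @h Z.transpose ⟨by
    rw [Metric.mem_ball, dist_eq_norm] at hZ ⊢
    rw [← Matrix.frobenius_norm_transpose, Matrix.transpose_sub]
    simpa [matMul] using hZ, by
    simpa [lowRank, Matrix.rank_transpose, and_comm, and_assoc, and_left_comm] using hZr⟩
  rw [mem_ball_matrix_prod] at hXY
  refine ⟨(Y.transpose, X.transpose), mem_ball_matrix_prod.2 ⟨?_, ?_⟩, ?_⟩
  · rw [← Matrix.transpose_sub, Matrix.frobenius_norm_transpose]; exact hXY.2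
  · rw [← Matrix.transpose_sub, Matrix.frobenius_norm_transpose]; exact hXY.1
  · have := congrArg Matrix.transpose hZ'
    simpa [matMul] using this

theorem rank_mul_eq_right_of_locallyOpenAtIn {m k n : ℕ} (hk : k < min m n)
    {W₁ : Matrix (Fin m) (Fin k) ℝ} {W₂ : Matrix (Fin k) (Fin n) ℝ}
    (h : LocallyOpenAtIn (matMul m k n) (lowRank m k n) (W₁, W₂)) :
    (W₁ * W₂).rank = W₂.rank := by
  rw [lt_min_iff] at hk
  by_contra hne
  have hlt : (W₁ * W₂).rank < W₂.rank := lt_of_le_of_ne (Matrix.rank_mul_le_right _ _) hne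
  have hr1 := rank_add_finrank_nullSp (W₁ * W₂)
  have hr2 := rank_add_finrank_nullSp W₂
  obtain ⟨v, hv, hv2⟩ : ∃ v ∈ nullSp (W₁ * W₂), v ∉ nullSp W₂ := by
    by_contra! hcon
    have := Submodule.finrank_mono (show nullSp (W₁ * W₂) ≤ nullSp W₂ from hcon)
    omega
  have hrk : (W₁ * W₂).rank ≤ k := (Matrix.rank_mul_le_left _ _).trans W₁.rank_le_width
  obtain ⟨D, E, hvD, hD, hE⟩ := exists_forall_nullSp_add_smul_eq (W₁ * W₂) hk.1.le hk.2 hrk hv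
  have hopen : {V : Matrix (Fin k) (Fin n) ℝ | V.mulVec v ≠ 0} ∈ 𝓝 W₂ := by
    refine IsOpen.mem_nhds ?_ (fun h0 => hv2 h0)
    exact isOpen_ne_fun (by fun_prop) continuous_const
  obtain ⟨ε, hε, hball⟩ := Metric.mem_nhds_iff.1 hopen
  obtain ⟨δ, hδ, h⟩ := h ε hε
  have hpos : 0 < ‖E‖ + 1 := by positivity
  set η : ℝ := δ / (‖E‖ + 1) with hη
  have hη0 : 0 < η := by positivity
  let := Matrix.frobeniusNormedSpace (R := ℝ) (α := ℝ) (m := Fin m) (n := Fin n)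
  obtain ⟨⟨X, Y⟩, hXY, hZ⟩ := @h (W₁ * W₂ + η • E) ⟨by
    rw [Metric.mem_ball, dist_eq_norm]
    simp only [matMul, add_sub_cancel_left]
    rw [norm_smul, Real.norm_of_nonneg hη0.le, hη, div_mul_eq_mul_div, div_lt_iff₀ hpos]
    nlinarith, by
    have := rank_add_finrank_nullSp (W₁ * W₂ + η • E)
    rw [hE η hη0.ne', hD] at this
    simp only [lowRank, Set.mem_ofPred_eq]
    omega⟩
  have hZ : X * Y = W₁ * W₂ + η • E := hZ
  have hYD : nullSp Y ≤ D := by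
    rw [← hE η hη0.ne', ← hZ]
    intro x hx
    have hx : Y.mulVec x = 0 := hx
    change (X * Y).mulVec x = 0
    rw [← Matrix.mulVec_mulVec, hx, Matrix.mulVec_zero]
  have hY := rank_add_finrank_nullSp Y
  have hYk := Y.rank_le_height
  -- `Y` has only k rows, so its kernel has dimension at least n - k = dim D.
  have hDY : nullSp Y = D := Submodule.eq_of_le_of_finrank_le hYD (by omega)
  rw [mem_ball_matrix_prod] at hXY
  have hYb : Y ∈ Metric.ball W₂ ε := by rw [Metric.mem_ball, dist_eq_norm]; exact hXY.2
  exact hball hYb (hDY ▸ hvD : v ∈ nullSp Y)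

theorem rank_mul_eq_left_of_locallyOpenAtIn {m k n : ℕ} (hk : k < min m n)
    {W₁ : Matrix (Fin m) (Fin k) ℝ} {W₂ : Matrix (Fin k) (Fin n) ℝ}
    (h : LocallyOpenAtIn (matMul m k n) (lowRank m k n) (W₁, W₂)) :
    (W₁ * W₂).rank = W₁.rank := by
  have := rank_mul_eq_right_of_locallyOpenAtIn (by rwa [min_comm]) h.transpose
  rwa [← Matrix.transpose_mul, Matrix.rank_transpose, Matrix.rank_transpose] at this

/-! ### Full-rank completions -/

/-- Adding `V₁` does not change the product with `W₂`, and an injective left factor preserves rank.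
Conversely, equal ranks make C(W₂) a complement of N(W₁), on which the correction can be made to
vanish. -/
theorem exists_mul_eq_zero_rank_add_eq_iff {m k n : ℕ} (hk : k ≤ m)
    {W₁ : Matrix (Fin m) (Fin k) ℝ} {W₂ : Matrix (Fin k) (Fin n) ℝ} (hr : W₁.rank = W₂.rank) :
    (∃ V₁ : Matrix (Fin m) (Fin k) ℝ, V₁ * W₂ = 0 ∧ (W₁ + V₁).rank = k) ↔
      (W₁ * W₂).rank = W₂.rank := by
  have h1 := rank_mul_add_finrank W₁ W₂
  have h2 := rank_add_finrank_nullSp W₁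
  constructor
  · rintro ⟨V, hV, hVr⟩
    have h3 := rank_mul_add_finrank (W₁ + V) W₂
    have h4 := rank_add_finrank_nullSp (W₁ + V)
    rw [Matrix.add_mul, hV, add_zero] at h3
    have := Submodule.finrank_mono (inf_le_left : nullSp (W₁ + V) ⊓ colSp W₂ ≤ _)
    omega
  · intro h
    have hd : Disjoint (nullSp W₁) (colSp W₂) := by
      rw [disjoint_iff, ← Submodule.finrank_eq_zero (R := ℝ)]; omega
    have hC : IsCompl (LinearMap.ker W₁.mulVecLin) (colSp W₂) := by
      refine Submodule.isCompl_iff_disjoint _ _ ?_ |>.2 hd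
      have : W₂.rank = Module.finrank ℝ (colSp W₂) := rfl
      have : Module.finrank ℝ (nullSp W₁) = Module.finrank ℝ (LinearMap.ker W₁.mulVecLin) := rfl
      simp only [Module.finrank_fin_fun]
      omega
    obtain ⟨g, hg0, hg⟩ := exists_forall_injective_add_smul W₁.mulVecLin (colSp W₂) hC (by simpa)
    have hg' : (LinearMap.toMatrix' g).mulVecLin = g := by
      rw [← Matrix.toLin'_apply', Matrix.toLin'_toMatrix']
    refine ⟨LinearMap.toMatrix' g, ?_, rank_eq_width_of_injective ?_⟩
    · apply Matrix.toLin'.injective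
      rw [Matrix.toLin'_mul, Matrix.toLin'_toMatrix', map_zero]
      exact LinearMap.ext fun x => hg0 _ ⟨x, rfl⟩
    · rw [Matrix.mulVecLin_add, hg']
      simpa using hg 1 one_ne_zero

/-! ### Approximate factorization by Schur complements -/

/-- Left and right partial inverses of `X` and `Y` when `N(X)` and `C(Y)` are complementary;
`J * K` is the projection onto `N(X)` along `C(Y)`, factored through `ℝ^q`. -/
theorem exists_partial_inverses {m k n : ℕ} {X : Matrix (Fin m) (Fin k) ℝ}
    {Y : Matrix (Fin k) (Fin n) ℝ} (hX : (X * Y).rank = X.rank) (hY : (X * Y).rank = Y.rank) :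
    ∃ (q : ℕ) (A : Matrix (Fin k) (Fin m) ℝ) (B : Matrix (Fin n) (Fin k) ℝ)
      (J : Matrix (Fin k) (Fin q) ℝ) (K : Matrix (Fin q) (Fin k) ℝ),
      X.rank + q = k ∧ A * X + J * K = 1 ∧ Y * B + J * K = 1 ∧ K * J = 1 ∧ X * J = 0 ∧
      K * Y = 0 ∧ K * A = 0 ∧ B * J = 0 := by
  have h1 := rank_mul_add_finrank X Y
  have h2 := rank_add_finrank_nullSp X
  have hd : Disjoint (nullSp X) (colSp Y) := by
    rw [disjoint_iff, ← Submodule.finrank_eq_zero (R := ℝ)]; omega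
  have hC : IsCompl (nullSp X) (colSp Y) := by
    refine Submodule.isCompl_iff_disjoint _ _ ?_ |>.2 hd
    have : Y.rank = Module.finrank ℝ (colSp Y) := rfl
    simp only [Module.finrank_fin_fun]
    omega
  obtain ⟨q, hq⟩ : ∃ q, Module.finrank ℝ (nullSp X) = q := ⟨_, rfl⟩
  let b : nullSp X ≃ₗ[ℝ] (Fin q → ℝ) := LinearEquiv.ofFinrankEq _ _ (by simpa using hq)
  let j : (Fin q → ℝ) →ₗ[ℝ] (Fin k → ℝ) := (nullSp X).subtype ∘ₗ b.symm
  let κ : (Fin k → ℝ) →ₗ[ℝ] (Fin q → ℝ) := b ∘ₗ Submodule.projectionOnto _ _ hC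
  -- The projection onto C(Y) along N(X). Ending `A` with `π` gives K A = 0; starting `B` with it
  -- gives B J = 0.
  let π : (Fin k → ℝ) →ₗ[ℝ] (Fin k → ℝ) := LinearMap.id - j ∘ₗ κ
  have hκj : κ ∘ₗ j = LinearMap.id := by
    refine LinearMap.ext fun x => ?_; simp [κ, j]
  have hXj (x) : X.mulVecLin (j x) = 0 := (b.symm x).2
  have hκY (x) : κ (Y.mulVecLin x) = 0 := by
    simp only [κ, LinearMap.comp_apply]
    rw [(Submodule.projectionOnto_apply_eq_zero_iff hC).2 ⟨x, rfl⟩]; simp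
  have hκj' (x) : κ (j x) = x := LinearMap.congr_fun hκj x
  have hκπ (x) : κ (π x) = 0 := by simp [π, hκj']
  have hπj (x) : π (j x) = 0 := by simp [π, hκj']
  have hππ (x) : π (π x) = π x := by
    have : π (π x) = π x - j (κ (π x)) := rfl
    rw [this, hκπ, map_zero, sub_zero]
  have hker (x) (hx : X.mulVecLin x = 0) : π x = 0 := by
    have : j (κ x) = x := by
      simp [j, κ, Submodule.projectionOnto_apply_of_mem_left hC (x := x) hx]
    simp [π, this]
  have hran (x) : π x ∈ LinearMap.range Y.mulVecLin := by
    have := Submodule.sub_projection_mem hC x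
    have h : π x = x - Submodule.projection _ _ hC x := by simp [π, j, κ]
    rw [h]; exact this
  obtain ⟨s, hs⟩ := X.mulVecLin.rangeRestrict.exists_rightInverse_of_surjective
    X.mulVecLin.range_rangeRestrict
  obtain ⟨α, hα⟩ := LinearMap.exists_extend (π ∘ₗ s)
  obtain ⟨t, ht⟩ := Y.mulVecLin.rangeRestrict.exists_rightInverse_of_surjective
    Y.mulVecLin.range_rangeRestrict
  have hαX (x) : α (X.mulVecLin x) = π x := by
    have e1 : α (X.mulVecLin x) = π (s (X.mulVecLin.rangeRestrict x)) :=
      LinearMap.congr_fun hα (X.mulVecLin.rangeRestrict x)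
    have e2 : X.mulVecLin (s (X.mulVecLin.rangeRestrict x)) = X.mulVecLin x :=
      congrArg Subtype.val (LinearMap.congr_fun hs (X.mulVecLin.rangeRestrict x))
    rw [e1, ← sub_eq_zero, ← map_sub]
    exact hker _ (by rw [map_sub, e2, sub_self])
  have htY (x) : Y.mulVecLin (t ⟨π x, hran x⟩) = π x :=
    congrArg Subtype.val (LinearMap.congr_fun ht ⟨π x, hran x⟩)
  have hid (x) : π x + j (κ x) = x := by simp [π]
  have hmul {a b : ℕ} (M : Matrix (Fin a) (Fin b) ℝ) : Matrix.toLin' M = M.mulVecLin := rfl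
  refine ⟨q, LinearMap.toMatrix' (π ∘ₗ α),
    LinearMap.toMatrix' (t ∘ₗ π.codRestrict _ hran ∘ₗ π), LinearMap.toMatrix' j,
    LinearMap.toMatrix' κ, by omega, ?_, ?_, ?_, ?_, ?_, ?_, ?_⟩ <;>
  apply Matrix.toLin'.injective <;> refine LinearMap.ext fun x => ?_ <;>
  simp only [map_add, Matrix.toLin'_mul, Matrix.toLin'_toMatrix', hmul X, hmul Y,
    LinearMap.add_apply, LinearMap.comp_apply, Matrix.toLin'_one, LinearMap.id_apply,
    map_zero, LinearMap.zero_apply, hαX, hππ, hid, hκj', hXj, hκY, hκπ, hπj]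
  · have : (LinearMap.codRestrict (LinearMap.range Y.mulVecLin) π hran) (π x) =
        ⟨π x, hran x⟩ := Subtype.ext (hππ x)
    rw [this, htY, hid]

/-- The columns of `P` are an orthonormal basis of a q-dimensional space containing C(S), and Q =
PᵀS. The bound on `P` only uses that its entries are at most 1 in absolute value. -/
theorem exists_mul_eq_norm_le {m n q : ℕ} (hq : q ≤ m) (S : Matrix (Fin m) (Fin n) ℝ)
    (hS : S.rank ≤ q) : ∃ (P : Matrix (Fin m) (Fin q) ℝ) (Q : Matrix (Fin q) (Fin n) ℝ),
      S = P * Q ∧ ‖P‖ ≤ ((m : ℝ) * q) ^ (1 / 2 : ℝ) ∧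
      ‖Q‖ ≤ ((m : ℝ) * q) ^ (1 / 2 : ℝ) * ‖S‖ := by
  let e := (WithLp.linearEquiv 2 ℝ (Fin m → ℝ)).symm
  obtain ⟨U, hSU, -, hU⟩ := Submodule.exists_between_finrank_eq
    (p := (colSp S).map (e : _ →ₗ[ℝ] EuclideanSpace ℝ (Fin m))) (q := ⊤) (d := q) le_top
    (by rw [LinearEquiv.finrank_map_eq]; exact hS) (by simpa using hq)
  let b := (stdOrthonormalBasis ℝ U).reindex (finCongr hU)
  let P : Matrix (Fin m) (Fin q) ℝ := Matrix.of fun i a => (b a : EuclideanSpace ℝ (Fin m)) i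
  have hP : ‖P‖ ≤ ((m : ℝ) * q) ^ (1 / 2 : ℝ) := by
    rw [Matrix.frobenius_norm_def]
    refine Real.rpow_le_rpow (by positivity) ?_ (by norm_num)
    have hle (i a) : ‖P i a‖ ^ (2 : ℝ) ≤ 1 := by
      refine Real.rpow_le_one (norm_nonneg _) ?_ (by norm_num)
      refine (PiLp.norm_apply_le (b a : EuclideanSpace ℝ (Fin m)) i).trans ?_
      exact (b.norm_eq_one a).le
    refine (Finset.sum_le_sum fun i _ => Finset.sum_le_sum fun a _ => hle i a).trans ?_
    simp
  refine ⟨P, P.transpose * S, ?_, hP, ?_⟩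
  · ext i j
    have hx : e (S.col j) ∈ U := hSU ⟨S.col j, ⟨Pi.single j 1, by simp⟩, rfl⟩
    have h := congrArg (fun y : U => (y : EuclideanSpace ℝ (Fin m)) i) (b.sum_repr' ⟨_, hx⟩)
    simp only [Matrix.mul_apply, Matrix.transpose_apply]
    simp [e, PiLp.inner_apply] at h
    rw [← h]
    refine Finset.sum_congr rfl fun a _ => ?_
    simp [P, mul_comm]
  · refine (Matrix.frobenius_norm_mul _ _).trans ?_
    rw [Matrix.frobenius_norm_transpose]
    gcongr

theorem exists_inverse_one_add {k : ℕ} (E : Matrix (Fin k) (Fin k) ℝ) (hE : ‖E‖ ≤ 1 / 2) :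
    ∃ N : Matrix (Fin k) (Fin k) ℝ, N * (1 + E) = 1 ∧ (1 + E) * N = 1 ∧ ‖N - 1‖ ≤ 2 * ‖E‖ := by
  let := Matrix.frobeniusNormedRing (m := Fin k) (α := ℝ)
  let := Matrix.frobeniusNormedSpace (R := ℝ) (α := ℝ) (m := Fin k) (n := Fin k)
  have : CompleteSpace (Matrix (Fin k) (Fin k) ℝ) := FiniteDimensional.complete ℝ _
  have hu : IsUnit (1 + E) := by
    have := isUnit_one_sub_of_norm_lt_one (x := -E) (by rw [norm_neg]; linarith)
    rwa [sub_neg_eq_add] at this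
  obtain ⟨u, hu⟩ := hu
  have h1 : (↑u⁻¹ : Matrix (Fin k) (Fin k) ℝ) * (1 + E) = 1 := by rw [← hu]; simp
  have h2 : (1 + E) * (↑u⁻¹ : Matrix (Fin k) (Fin k) ℝ) = 1 := by rw [← hu]; simp
  refine ⟨_, h1, h2, ?_⟩
  set N : Matrix (Fin k) (Fin k) ℝ := ↑u⁻¹
  -- With ‖E‖ ≤ 1/2, the term containing N - 1 is absorbed on the left.
  have h3 : N - 1 = -(E * (N - 1)) - E := by
    linear_combination (norm := noncomm_ring) h2
  have h4 : ‖N - 1‖ ≤ ‖E‖ * ‖N - 1‖ + ‖E‖ := by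
    conv_lhs => rw [h3]
    refine (norm_sub_le _ _).trans ?_
    rw [norm_neg]
    gcongr
    exact norm_mul_le _ _
  nlinarith [norm_nonneg (N - 1)]

/-- Schur complements: near `X * Y`, every matrix of rank at most `k` is a product of factors close
to `X` and `Y`, up to a small remainder of rank at most `k - rank X`. -/
theorem exists_approx_factorization {m k n : ℕ} {X : Matrix (Fin m) (Fin k) ℝ}
    {Y : Matrix (Fin k) (Fin n) ℝ} (hX : (X * Y).rank = X.rank) (hY : (X * Y).rank = Y.rank) :
    ∃ (q : ℕ) (J : Matrix (Fin k) (Fin q) ℝ) (K : Matrix (Fin q) (Fin k) ℝ) (C r : ℝ),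
      X.rank + q = k ∧ K * J = 1 ∧ 0 < C ∧ 0 < r ∧
      ∀ Z : Matrix (Fin m) (Fin n) ℝ, Z.rank ≤ k → ‖Z - X * Y‖ ≤ r →
        ∃ (X' : Matrix (Fin m) (Fin k) ℝ) (Y' : Matrix (Fin k) (Fin n) ℝ),
          X' * J = 0 ∧ K * Y' = 0 ∧ (Z - X' * Y').rank ≤ q ∧
          ‖X' - X‖ ≤ C * ‖Z - X * Y‖ ∧ ‖Y' - Y‖ ≤ C * ‖Z - X * Y‖ ∧
          ‖Z - X' * Y'‖ ≤ C * ‖Z - X * Y‖ := by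
  obtain ⟨q, A, B, J, K, hq, hA, hB, hKJ, hXJ, hKY, hKA, hBJ⟩ := exists_partial_inverses hX hY
  set a := ‖A‖ with ha
  set b := ‖B‖ with hb
  set x := ‖X‖ with hx
  set y := ‖Y‖ with hy
  have ha0 : 0 ≤ a := norm_nonneg _
  have hb0 : 0 ≤ b := norm_nonneg _
  have hx0 : 0 ≤ x := norm_nonneg _
  have hy0 : 0 ≤ y := norm_nonneg _
  set c₁ := 2 * b + 2 * a * b * x with hc₁
  have hc0 : 0 ≤ c₁ := by positivity
  -- The radius ensures ‖A D B‖ ≤ 1/2 and d ≤ 1; the constant is the sum of the three final bounds.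
  refine ⟨q, J, K, 1 + c₁ * (y + a) + x * a + c₁ + a, 1 / (2 * a * b + 1), hq, hKJ,
    by positivity, by positivity, fun Z hZ hd => ?_⟩
  set D := Z - X * Y with hD
  set d := ‖D‖ with hdd
  have hd0 : 0 ≤ d := norm_nonneg _
  have hab0 : 0 ≤ a * b := by positivity
  rw [le_div_iff₀ (by positivity)] at hd
  have habd : 2 * (a * d * b) ≤ 1 := by nlinarith
  have hd1 : d ≤ 1 := by nlinarith [mul_nonneg hd0 hab0]
  have hEn : ‖A * D * B‖ ≤ a * d * b :=
    (Matrix.frobenius_norm_mul _ _).trans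
      (mul_le_mul_of_nonneg_right (Matrix.frobenius_norm_mul _ _) hb0)
  obtain ⟨N, -, hMN, hN⟩ := exists_inverse_one_add (A * D * B) (by linarith)
  have hXYB : X * (Y * B) = X := by
    rw [← eq_sub_iff_add_eq] at hB
    rw [hB, Matrix.mul_sub, ← Matrix.mul_assoc, hXJ, Matrix.zero_mul, Matrix.mul_one, sub_zero]
  have hAXY : A * X * Y = Y := by
    rw [← eq_sub_iff_add_eq] at hA
    rw [hA, Matrix.sub_mul, Matrix.mul_assoc, hKY, Matrix.mul_zero, Matrix.one_mul, sub_zero]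
  -- A X Y B = Y B = 1 - J K, so A Z B is invertible up to the block `J * K`. This yields X' = Z B N
  -- and Y' = A Z.
  have hM : 1 + A * D * B = J * K + A * Z * B := by
    rw [hD, Matrix.mul_sub, Matrix.sub_mul, ← Matrix.mul_assoc, hAXY, ← hB]
    abel
  rw [hM] at hMN
  have hKN : K * N = K := by
    calc K * N = K * J * K * N + K * A * (Z * B * N) := by
          rw [hKJ, hKA, Matrix.one_mul, Matrix.zero_mul, add_zero]
      _ = K * ((J * K + A * Z * B) * N) := by
          simp only [Matrix.add_mul, Matrix.mul_add, Matrix.mul_assoc]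
      _ = K := by rw [hMN, Matrix.mul_one]
  have hNM : N * (J * K + A * Z * B) = 1 := mul_eq_one_comm.1 hMN
  have hNJ : N * J = J := by
    calc N * J = N * (J * (K * J) + A * Z * (B * J)) := by
          rw [hKJ, hBJ, Matrix.mul_one, Matrix.mul_zero, add_zero]
      _ = N * (J * K + A * Z * B) * J := by
          simp only [Matrix.add_mul, Matrix.mul_add, Matrix.mul_assoc]
      _ = J := by rw [hNM, Matrix.one_mul]
  have hAZBN : A * Z * B * N = 1 - J * K := by
    rw [eq_sub_iff_add_eq', ← hMN, Matrix.add_mul, Matrix.mul_assoc J, hKN]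
  have hKY' : K * (A * Z) = 0 := by rw [← Matrix.mul_assoc, hKA, Matrix.zero_mul]
  have hAS : A * (Z - Z * B * N * (A * Z)) = 0 := by
    calc A * (Z - Z * B * N * (A * Z)) = A * Z - A * Z * B * N * (A * Z) := by
          simp only [Matrix.mul_sub, Matrix.mul_assoc]
      _ = 0 := by
          rw [hAZBN, Matrix.sub_mul, Matrix.one_mul, Matrix.mul_assoc, hKY', Matrix.mul_zero,
            sub_zero, sub_self]
  -- The remainder has columns in N(A) ∩ C(Z), of dimension rank Z - rank(AZ), and rank(AZ) ≥ k - q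
  -- by invertibility of J K + A Z B.
  have hrank : (Z - Z * B * N * (A * Z)).rank ≤ q := by
    have h1 := rank_mul_add_finrank A Z
    have h2 : k ≤ q + (A * Z).rank := by
      calc k = ((J * K + A * Z * B) * N).rank := by rw [hMN, Matrix.rank_one, Fintype.card_fin]
        _ ≤ (J * K + A * Z * B).rank := Matrix.rank_mul_le_left _ _
        _ ≤ (J * K).rank + (A * Z * B).rank := matrix_rank_add_le _ _
        _ ≤ q + (A * Z).rank := add_le_add
          ((Matrix.rank_mul_le_left _ _).trans J.rank_le_width) (Matrix.rank_mul_le_left _ _)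
    have h3 : colSp (Z - Z * B * N * (A * Z)) ≤ nullSp A ⊓ colSp Z := by
      rintro _ ⟨v, rfl⟩
      refine ⟨?_, ((1 : Matrix (Fin n) (Fin n) ℝ) - B * N * (A * Z)).mulVec v, ?_⟩
      · change A.mulVec ((Z - Z * B * N * (A * Z)).mulVec v) = 0
        rw [Matrix.mulVec_mulVec, hAS, Matrix.zero_mulVec]
      · change Z.mulVec _ = (Z - Z * B * N * (A * Z)).mulVec v
        rw [Matrix.mulVec_mulVec, Matrix.mul_sub, Matrix.mul_one]
        simp only [Matrix.mul_assoc]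
    have h4 : (Z - Z * B * N * (A * Z)).rank ≤ _ := Submodule.finrank_mono h3
    omega
  have hZ' : Z = X * Y + D := by rw [hD]; abel
  have hX'X : ‖Z * B * N - X‖ ≤ c₁ * d := by
    have : Z * B * N - X = D * B + D * B * (N - 1) + X * (N - 1) := by
      rw [Matrix.mul_sub, Matrix.mul_sub, Matrix.mul_one, Matrix.mul_one, hZ', Matrix.add_mul,
        Matrix.mul_assoc X, hXYB, Matrix.add_mul]
      abel
    rw [this]
    have hDB : ‖D * B‖ ≤ d * b := Matrix.frobenius_norm_mul _ _
    have hN' : ‖N - 1‖ ≤ 2 * (a * d * b) := by linarith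
    have e1 : ‖D * B * (N - 1)‖ ≤ d * b * 1 :=
      (Matrix.frobenius_norm_mul _ _).trans
        (mul_le_mul hDB (by linarith) (norm_nonneg _) (by positivity))
    have e2 : ‖X * (N - 1)‖ ≤ x * (2 * (a * d * b)) :=
      (Matrix.frobenius_norm_mul _ _).trans (mul_le_mul_of_nonneg_left hN' hx0)
    refine (norm_add₃_le).trans ?_
    rw [hc₁]
    linarith
  have hY'Y : ‖A * Z - Y‖ ≤ a * d := by
    have : A * Z - Y = A * D := by
      rw [hZ', Matrix.mul_add, ← Matrix.mul_assoc, hAXY]; abel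
    rw [this]
    exact Matrix.frobenius_norm_mul _ _
  have hY' : ‖A * Z‖ ≤ y + a := by
    have := norm_le_norm_add_norm_sub' (A * Z) Y
    nlinarith
  have hS : ‖Z - Z * B * N * (A * Z)‖ ≤ (1 + c₁ * (y + a) + x * a) * d := by
    have : Z - Z * B * N * (A * Z) =
        D - (Z * B * N - X) * (A * Z) - X * (A * Z - Y) := by
      rw [Matrix.sub_mul, Matrix.mul_sub, hD]; abel
    rw [this]
    have e1 : ‖(Z * B * N - X) * (A * Z)‖ ≤ c₁ * d * (y + a) :=
      (Matrix.frobenius_norm_mul _ _).trans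
        (mul_le_mul hX'X hY' (norm_nonneg _) (by positivity))
    have e2 : ‖X * (A * Z - Y)‖ ≤ x * (a * d) :=
      (Matrix.frobenius_norm_mul _ _).trans (mul_le_mul_of_nonneg_left hY'Y hx0)
    have e3 := norm_sub_le (D - (Z * B * N - X) * (A * Z)) (X * (A * Z - Y))
    have e4 := norm_sub_le D ((Z * B * N - X) * (A * Z))
    linarith
  have hs0 : 0 ≤ c₁ * (y + a) := by positivity
  have hs1 : 0 ≤ x * a := by positivity
  refine ⟨Z * B * N, A * Z, ?_, hKY', hrank, hX'X.trans ?_, hY'Y.trans ?_, hS.trans ?_⟩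
  · rw [Matrix.mul_assoc, hNJ, Matrix.mul_assoc, hBJ, Matrix.mul_zero]
  all_goals
    refine mul_le_mul_of_nonneg_right ?_ hd0
    linarith

/-! ### Quadratic and linear covering radii -/

theorem exists_coversBall_mul_sq {m k n : ℕ} (hk : k ≤ m) {X : Matrix (Fin m) (Fin k) ℝ}
    {Y : Matrix (Fin k) (Fin n) ℝ} (hX : (X * Y).rank = X.rank) (hY : (X * Y).rank = Y.rank) :
    ∃ c : ℝ, 0 < c ∧ ∀ ε : ℝ, 0 < ε → ε ≤ 1 →
      CoversBall (matMul m k n) (lowRank m k n) (X, Y) ε (c * ε ^ 2) := by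
  obtain ⟨q, J, K, C, r, hq, hKJ, hC, hr, h⟩ := exists_approx_factorization hX hY
  set p : ℝ := ((m : ℝ) * q) ^ (1 / 2 : ℝ) with hp
  have hp0 : 0 ≤ p := by positivity
  set G : ℝ := C + p * ‖K‖ + ‖J‖ * (p * C) + 1 with hG
  have hpK : 0 ≤ p * ‖K‖ := by positivity
  have hJp : 0 ≤ ‖J‖ * (p * C) := by positivity
  have hG0 : 1 ≤ G := by linarith
  have hGpos : 0 < G := by linarith
  refine ⟨min r (1 / (8 * G ^ 2)), by positivity, fun ε hε hε1 Z ⟨hZ, hZr⟩ => ?_⟩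
  rw [Metric.mem_ball, dist_eq_norm] at hZ
  change ‖Z - X * Y‖ < _ at hZ
  have hε2 : 0 < ε ^ 2 := by positivity
  have hε2' : ε ^ 2 ≤ 1 := pow_le_one₀ hε.le hε1
  have hZr1 : ‖Z - X * Y‖ ≤ r := by
    refine hZ.le.trans ?_
    calc min r (1 / (8 * G ^ 2)) * ε ^ 2 ≤ r * 1 :=
          mul_le_mul (min_le_left _ _) hε2' hε2.le hr.le
      _ = r := mul_one r
  have hZr2 : ‖Z - X * Y‖ < 1 / (8 * G ^ 2) * ε ^ 2 :=
    hZ.trans_le (mul_le_mul_of_nonneg_right (min_le_right _ _) hε2.le)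
  obtain ⟨X', Y', hXJ, hKY, hSq, hX', hY', hS⟩ := h Z (hZr.trans (min_le_right _ _)) hZr1
  obtain ⟨P, Q, hPQ, hP, hQ⟩ := exists_mul_eq_norm_le (by omega) (Z - X' * Y') hSq
  set d := ‖Z - X * Y‖ with hd
  have hd0 : 0 ≤ d := norm_nonneg _
  rw [one_div, ← div_eq_inv_mul, lt_div_iff₀ (by positivity)] at hZr2
  let := Matrix.frobeniusNormedSpace (R := ℝ) (α := ℝ) (m := Fin m) (n := Fin k)
  let := Matrix.frobeniusNormedSpace (R := ℝ) (α := ℝ) (m := Fin k) (n := Fin n)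
  -- Balances the corrections: t P K costs at most ε/2, and t⁻¹ J Q at most 2G²d/ε ≤ ε/4 because d <
  -- ε²/(8G²).
  set t : ℝ := ε / (2 * G) with ht
  have ht0 : 0 < t := by positivity
  have hGd : G * d ≤ ε / 8 := by
    have : G * d ≤ G * d * G := le_mul_of_one_le_right (by positivity) hG0
    nlinarith
  refine ⟨(X' + t • (P * K), Y' + t⁻¹ • (J * Q)), mem_ball_matrix_prod.2 ⟨?_, ?_⟩, ?_⟩
  · have e1 : ‖t • (P * K)‖ ≤ t * (p * ‖K‖) := by
      rw [norm_smul, Real.norm_of_nonneg ht0.le]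
      gcongr
      refine (Matrix.frobenius_norm_mul _ _).trans ?_
      gcongr
    have e2 : X' + t • (P * K) - X = (X' - X) + t • (P * K) := by abel
    have e3 : G * t = ε / 2 := by rw [ht]; field_simp
    change ‖X' + t • (P * K) - X‖ < ε
    rw [e2]
    have e4 := norm_add_le (X' - X) (t • (P * K))
    have e5 : C * d ≤ G * d := mul_le_mul_of_nonneg_right (by linarith) hd0
    have e6 : p * ‖K‖ * t ≤ G * t := mul_le_mul_of_nonneg_right (by linarith) ht0.le
    linarith
  · have e1 : ‖t⁻¹ • (J * Q)‖ ≤ t⁻¹ * (‖J‖ * (p * (C * d))) := by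
      rw [norm_smul, Real.norm_of_nonneg (inv_nonneg.2 ht0.le)]
      gcongr
      refine (Matrix.frobenius_norm_mul _ _).trans ?_
      gcongr
      refine hQ.trans ?_
      gcongr
    have e2 : Y' + t⁻¹ • (J * Q) - Y = (Y' - Y) + t⁻¹ • (J * Q) := by abel
    have e3 : t⁻¹ * (G * d) ≤ ε / 4 := by
      rw [ht, inv_div, div_mul_eq_mul_div, div_le_iff₀ hε]
      nlinarith
    change ‖Y' + t⁻¹ • (J * Q) - Y‖ < ε
    rw [e2]
    have e4 := norm_add_le (Y' - Y) (t⁻¹ • (J * Q))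
    have e5 : C * d ≤ G * d := mul_le_mul_of_nonneg_right (by linarith) hd0
    have e6 : ‖J‖ * (p * C) * d ≤ G * d := mul_le_mul_of_nonneg_right (by linarith) hd0
    have e7 : t⁻¹ * (‖J‖ * (p * C) * d) ≤ t⁻¹ * (G * d) :=
      mul_le_mul_of_nonneg_left e6 (inv_nonneg.2 ht0.le)
    have e8 : ‖J‖ * (p * (C * d)) = ‖J‖ * (p * C) * d := by ring
    rw [e8] at e1
    linarith
  · change (X' + t • (P * K)) * (Y' + t⁻¹ • (J * Q)) = Z
    have e1 : X' * (J * Q) = 0 := by rw [← Matrix.mul_assoc, hXJ, Matrix.zero_mul]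
    have e2 : P * K * Y' = 0 := by rw [Matrix.mul_assoc, hKY, Matrix.mul_zero]
    have e3 : P * K * (J * Q) = P * Q := by
      rw [Matrix.mul_assoc, ← Matrix.mul_assoc K, hKJ, Matrix.one_mul]
    simp only [Matrix.add_mul, Matrix.mul_add, Matrix.smul_mul, Matrix.mul_smul, e1, e2, e3,
      smul_zero, add_zero, zero_add, smul_smul, inv_mul_cancel₀ ht0.ne',
      one_smul, ← hPQ]
    abel

theorem exists_coversBall_mul {m k n : ℕ} {X : Matrix (Fin m) (Fin k) ℝ}
    {Y : Matrix (Fin k) (Fin n) ℝ} (hX : (X * Y).rank = X.rank) (hY : (X * Y).rank = Y.rank)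
    (hXk : X.rank = k) :
    ∃ c : ℝ, 0 < c ∧ ∀ ε : ℝ, 0 < ε → ε ≤ 1 →
      CoversBall (matMul m k n) (lowRank m k n) (X, Y) ε (c * ε) := by
  obtain ⟨q, J, K, C, r, hq, hKJ, hC, hr, h⟩ := exists_approx_factorization hX hY
  refine ⟨min r (1 / C), by positivity, fun ε hε hε1 Z ⟨hZ, hZr⟩ => ?_⟩
  rw [Metric.mem_ball, dist_eq_norm] at hZ
  change ‖Z - X * Y‖ < _ at hZ
  have hZr1 : ‖Z - X * Y‖ ≤ r := by
    refine hZ.le.trans ?_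
    calc min r (1 / C) * ε ≤ r * 1 := mul_le_mul (min_le_left _ _) hε1 hε.le hr.le
      _ = r := mul_one r
  have hZr2 : C * ‖Z - X * Y‖ < ε := by
    have := hZ.trans_le (mul_le_mul_of_nonneg_right (min_le_right _ _) hε.le)
    rwa [one_div, ← div_eq_inv_mul, lt_div_iff₀' hC] at this
  obtain ⟨X', Y', -, -, hSq, hX', hY', -⟩ := h Z (hZr.trans (min_le_right _ _)) hZr1
  refine ⟨(X', Y'), mem_ball_matrix_prod.2 ⟨hX'.trans_lt hZr2, hY'.trans_lt hZr2⟩, ?_⟩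
  -- Full column rank forces q = 0, so no remainder is left.
  have h0 : (Z - X' * Y').rank = 0 := by omega
  have h1 : (Z - X' * Y').mulVecLin = 0 :=
    LinearMap.range_eq_bot.1 (Submodule.finrank_eq_zero.1 h0)
  have h2 : Z - X' * Y' = 0 := Matrix.toLin'.injective (by rw [map_zero]; exact h1)
  exact (sub_eq_zero.1 h2).symm

/-! ### Asymptotics and assembly -/

theorem CoversBall.mono {X Y : Type*} [PseudoMetricSpace X] [PseudoMetricSpace Y]
    {F : X → Y} {R : Set Y} {w : X} {ε ε' δ : ℝ} (h : CoversBall F R w ε δ) (hε : ε ≤ ε') :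
    CoversBall F R w ε' δ :=
  h.trans (Set.image_mono (Metric.ball_subset_ball hε))

theorem LocallyOpenAtIn.of_forall_le_one {X Y : Type*} [PseudoMetricSpace X] [PseudoMetricSpace Y]
    {F : X → Y} {R : Set Y} {w : X} {δ : ℝ → ℝ} (hδ : ∀ ε, 0 < ε → 0 < δ ε)
    (h : ∀ ε : ℝ, 0 < ε → ε ≤ 1 → CoversBall F R w ε (δ ε)) : LocallyOpenAtIn F R w :=
  fun ε hε => ⟨δ (min ε 1), hδ _ (by positivity),
    (h _ (by positivity) (min_le_right _ _)).mono (min_le_left _ _)⟩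

theorem isBigO_nhdsGT_zero_of_forall_le_one {f g : ℝ → ℝ} (c : ℝ)
    (h : ∀ ε : ℝ, 0 < ε → ε ≤ 1 → |f ε| ≤ c * |g ε|) : f =O[𝓝[>] 0] g := by
  refine IsBigO.of_bound c ?_
  filter_upwards [Ioc_mem_nhdsGT (zero_lt_one' ℝ)] with ε hε
  exact h ε hε.1 hε.2

theorem exists_mul_eq_zero_rank_add_eq_iff' {m k n : ℕ} (hk : k ≤ n)
    {W₁ : Matrix (Fin m) (Fin k) ℝ} {W₂ : Matrix (Fin k) (Fin n) ℝ} (hr : W₁.rank = W₂.rank) :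
    (∃ V₂ : Matrix (Fin k) (Fin n) ℝ, W₁ * V₂ = 0 ∧ (W₂ + V₂).rank = k) ↔
      (W₁ * W₂).rank = W₂.rank := by
  have h := exists_mul_eq_zero_rank_add_eq_iff hk (W₁ := W₂.transpose) (W₂ := W₁.transpose)
    (by simp only [Matrix.rank_transpose, hr])
  rw [← Matrix.transpose_mul, Matrix.rank_transpose, Matrix.rank_transpose, hr] at h
  rw [← h]
  constructor
  · rintro ⟨V, hV, hVr⟩
    refine ⟨V.transpose, by rw [← Matrix.transpose_mul, hV, Matrix.transpose_zero], ?_⟩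
    rwa [← Matrix.transpose_add, Matrix.rank_transpose]
  · rintro ⟨V, hV, hVr⟩
    refine ⟨V.transpose, ?_, ?_⟩
    · have := congrArg Matrix.transpose hV
      simpa using this
    · rw [← Matrix.rank_transpose]
      simpa using hVr

theorem theorem1 (m k n : ℕ) (hk : k < min m n)
    (W₁ : Matrix (Fin m) (Fin k) ℝ) (W₂ : Matrix (Fin k) (Fin n) ℝ) :
    (W₁.rank ≠ W₂.rank → ¬ LocallyOpenAtIn (matMul m k n) (lowRank m k n) (W₁, W₂)) ∧
    (W₁.rank = W₂.rank →
      List.TFAE [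
        ∃ V₁ : Matrix (Fin m) (Fin k) ℝ, V₁ * W₂ = 0 ∧ (W₁ + V₁).rank = k,
        ∃ V₂ : Matrix (Fin k) (Fin n) ℝ, W₁ * V₂ = 0 ∧ (W₂ + V₂).rank = k,
        Module.finrank ℝ ↥(nullSp W₁ ⊓ colSp W₂) = 0,
        Module.finrank ℝ ↥(nullSp W₂.transpose ⊓ colSp W₁.transpose) = 0,
        LocallyOpenAtIn (matMul m k n) (lowRank m k n) (W₁, W₂)]) ∧
    (LocallyOpenAtIn (matMul m k n) (lowRank m k n) (W₁, W₂) →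
      ∃ δ : ℝ → ℝ,
        (∀ ε : ℝ, 0 < ε → 0 < δ ε ∧
          CoversBall (matMul m k n) (lowRank m k n) (W₁, W₂) ε (δ ε)) ∧
        δ =O[𝓝[>] 0] (fun ε : ℝ => ε) ∧
        (fun ε : ℝ => ε ^ 2) =O[𝓝[>] 0] δ ∧
        (W₁.rank = k → (fun ε : ℝ => ε) =O[𝓝[>] 0] δ)) := by
  rw [lt_min_iff] at hk
  have hk' : k < min m n := lt_min hk.1 hk.2
  refine ⟨fun hne h => hne ?_, fun hr => ?_, fun h => ?_⟩
  · rw [← rank_mul_eq_left_of_locallyOpenAtIn hk' h, rank_mul_eq_right_of_locallyOpenAtIn hk' h]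
  · have h1 := exists_mul_eq_zero_rank_add_eq_iff hk.1.le hr
    have h2 := exists_mul_eq_zero_rank_add_eq_iff' hk.2.le hr
    have h3 := rank_mul_add_finrank W₁ W₂
    have h4 := rank_mul_add_finrank W₂.transpose W₁.transpose
    rw [← Matrix.transpose_mul, Matrix.rank_transpose, Matrix.rank_transpose] at h4
    tfae_have 1 ↔ 2 := h1.trans h2.symm
    tfae_have 1 ↔ 3 := h1.trans ⟨fun h => by omega, fun h => by omega⟩
    tfae_have 3 ↔ 4 := ⟨fun h => by omega, fun h => by omega⟩
    tfae_have 1 ↔ 5 := by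
      rw [h1]
      refine ⟨fun h => ?_, rank_mul_eq_right_of_locallyOpenAtIn hk'⟩
      obtain ⟨c, hc, hcov⟩ := exists_coversBall_mul_sq hk.1.le (h.trans hr.symm) h
      exact .of_forall_le_one (fun ε hε => by positivity) hcov
    tfae_finish
  · have hX := rank_mul_eq_left_of_locallyOpenAtIn hk' h
    have hY := rank_mul_eq_right_of_locallyOpenAtIn hk' h
    by_cases hr : W₁.rank = k
    · obtain ⟨c, hc, hcov⟩ := exists_coversBall_mul hX hY hr
      have hlin : (fun ε : ℝ => ε) =O[𝓝[>] 0] fun ε => c * min ε 1 :=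
        isBigO_nhdsGT_zero_of_forall_le_one c⁻¹ fun ε hε hε1 => by
          rw [min_eq_left hε1, abs_mul, abs_of_pos hc, inv_mul_cancel_left₀ hc.ne']
      -- The covering bound holds for ε ≤ 1; truncation extends it to all ε without affecting the
      -- limit at 0.
      refine ⟨fun ε => c * min ε 1, fun ε hε => ⟨by positivity,
        (hcov _ (by positivity) (min_le_right _ _)).mono (min_le_left _ _)⟩, ?_, ?_, fun _ => hlin⟩
      · refine isBigO_nhdsGT_zero_of_forall_le_one c fun ε hε hε1 => ?_
        rw [min_eq_left hε1, abs_mul, abs_of_pos hc]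
      · refine IsBigO.trans (isBigO_nhdsGT_zero_of_forall_le_one 1 fun ε hε hε1 => ?_) hlin
        rw [abs_of_pos hε, abs_of_pos (by positivity)]
        nlinarith
    · obtain ⟨c, hc, hcov⟩ := exists_coversBall_mul_sq hk.1.le hX hY
      refine ⟨fun ε => c * min ε 1 ^ 2, fun ε hε => ⟨by positivity,
        (hcov _ (by positivity) (min_le_right _ _)).mono (min_le_left _ _)⟩, ?_, ?_,
        fun h => absurd h hr⟩
      · refine isBigO_nhdsGT_zero_of_forall_le_one c fun ε hε hε1 => ?_
        rw [min_eq_left hε1, abs_mul, abs_of_pos hc, abs_of_pos hε,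
          abs_of_pos (by positivity : 0 < ε ^ 2)]
        gcongr
        nlinarith
      · refine isBigO_nhdsGT_zero_of_forall_le_one c⁻¹ fun ε hε hε1 => ?_
        rw [min_eq_left hε1, abs_mul, abs_of_pos hc, inv_mul_cancel_left₀ hc.ne']
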